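/- All Hilbert spaces are finite-dimensional and $\log=\log_2$. For a density operator $\rho$ with eigenvalues $(r_j)$ (listed with multiplicity) and $0\le\epsilon<1$ let $$\Delta_\epsilon(\rho):=\log\min\Bigl\{|J|\cdot\max_{j\in J}r_j \;:\; \sum_{j\in J}r_j\ge 1-\epsilon\Bigr\},$$ the minimum being over sets $J$ of eigenvalue indices. (In particular $\Delta_0(\rho)=\log\operatorname{rank}\rho+\log\|\rho\|_\infty=S_0(\rho)-S_\infty(\rho)$.) For density operators $\sigma,\omega$ let $F(\sigma,\omega)=\bigl(\operatorname{Tr}\sqrt{\sigma^{1/2}\omega\sigma^{1/2}}\bigr)^2$ be the Uhlmann fidelity. A protocol starts with Alice and Bob sharing a pure state $|\phi_{AB}\rangle$. It consists of finitely many operations, each of which is either a local action of one party (adjoining an ancilla in a pure state and applying a unitary to the whole local system) or the transmission of a subsystem, of some dimension $d_i$, of one party to the other party. At the end Alice discards a subsystem $A'$ and Bob discards a subsystem $B'$ of the final joint pure state $|\widetilde\psi_{ABA'B'}\rangle$ (where $A$, $B$ now denote the systems that are kept, and need not have the initial dimensions). The number of qubits exchanged is $C=\sum_i\log d_i$. The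 protocol takes $|\phi_{AB}\rangle$ to the pure state $|\psi_{AB}\rangle$ with fidelity $1-\epsilon$ if $F\bigl(\operatorname{Tr}_{A'B'}|\widetilde\psi\rangle\langle\widetilde\psi|,\,|\psi\rangle\langle\psi|\bigr)\ge 1-\epsilon$. **Theorem.** Let $0\le\epsilon<\tfrac14$ and $\delta=\sqrt[8]{4\epsilon}$. If a protocol takes $|\phi_{AB}\rangle$ to $|\psi_{AB}\rangle$ with fidelity $1-\epsilon$, exchanging a total of $C$ qubits, then $$2C\;\ge\;\Delta_\delta\bigl(\operatorname{Tr}_B|\psi\rangle\langle\psi|\bigr)-\Delta_0\bigl(\operatorname{Tr}_B|\phi\rangle\langle\phi|\bigr)+2\log(1-\delta).$$ -/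

import Mathlib

open scoped ComplexOrder MatrixOrder

universe u

namespace EntTrans

noncomputable section

/-- Vectors of the joint space `ℂ^A ⊗ ℂ^B`, with its Hilbert space structure; the first index belongs
to Alice, the second one to Bob. A pure state is a vector of norm one. -/
abbrev Ket (A B : Type u) [Fintype A] [Fintype B] : Type u := EuclideanSpace ℂ (A × B)

/-- The operator `|φ⟩⟨φ|`. -/
def ketbra {X : Type u} [Fintype X] (φ : EuclideanSpace ℂ X) : Matrix X X ℂ :=
  Matrix.of fun x y => φ x * star (φ y)

/-- The partial trace over Bob's system. -/
def traceB {A B : Type u} [Fintype B] (ρ : Matrix (A × B) (A × B) ℂ) : Matrix A A ℂ :=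
  Matrix.of fun a a' => ∑ b, ρ (a, b) (a', b)

/-- The partial trace over a subsystem `A'` of Alice and a subsystem `B'` of Bob. -/
def discardPrimed {A A' B B' : Type u} [Fintype A'] [Fintype B']
    (ρ : Matrix ((A × A') × (B × B')) ((A × A') × (B × B')) ℂ) : Matrix (A × B) (A × B) ℂ :=
  Matrix.of fun x y => ∑ s : A', ∑ t : B', ρ ((x.1, s), (x.2, t)) ((y.1, s), (y.2, t))

theorem isHermitian_ketbra {X : Type u} [Fintype X] (φ : EuclideanSpace ℂ X) :
    (ketbra φ).IsHermitian := by
  ext x y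
  simp [ketbra, Matrix.conjTranspose_apply, mul_comm]

theorem isHermitian_traceB {A B : Type u} [Fintype B] {ρ : Matrix (A × B) (A × B) ℂ}
    (h : ρ.IsHermitian) : (traceB ρ).IsHermitian := by
  ext a a'
  simp only [traceB, Matrix.conjTranspose_apply, Matrix.of_apply, star_sum]
  exact Finset.sum_congr rfl fun b _ => h.apply (a, b) (a', b)

/-- Alice's reduced operator `Tr_B |φ⟩⟨φ|` is Hermitian. -/
theorem isHermitian_traceB_ketbra {A B : Type u} [Fintype A] [Fintype B] (φ : Ket A B) :
    (traceB (ketbra φ)).IsHermitian :=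
  isHermitian_traceB (isHermitian_ketbra φ)

/-- The numbers `|J| · max_{j ∈ J} r_j`, where `(r_j)` are the eigenvalues of `ρ` counted with
multiplicity and `J` runs over the sets of eigenvalue indices of weight at least `1 - ε`.
(For `ε < 1` such a `J` is never empty.) -/
def deltaValues {A : Type u} [Fintype A] [DecidableEq A] (ε : ℝ) {ρ : Matrix A A ℂ}
    (hρ : ρ.IsHermitian) : Set ℝ :=
  {v | ∃ (J : Finset A) (hJ : J.Nonempty), 1 - ε ≤ ∑ j ∈ J, hρ.eigenvalues j ∧
    v = (J.card : ℝ) * J.sup' hJ hρ.eigenvalues}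

/-- `Δ_ε(ρ)`, for `0 ≤ ε < 1`: the binary logarithm of the minimum of `deltaValues`, which is a
finite set, and is not empty if `ρ` has trace one. -/
def Delta {A : Type u} [Fintype A] [DecidableEq A] (ε : ℝ) {ρ : Matrix A A ℂ}
    (hρ : ρ.IsHermitian) : ℝ :=
  Real.logb 2 (sInf (deltaValues ε hρ))

/-- The Uhlmann fidelity `F(σ, ω) = (Tr √(√σ ω √σ))²`. -/
def fidelity {X : Type u} [Fintype X] [DecidableEq X] (σ ω : Matrix X X ℂ) : ℝ :=
  (Matrix.trace (CFC.sqrt (CFC.sqrt σ * ω * CFC.sqrt σ))).re ^ 2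

/-- Adjoin an ancilla in the state `ξ` to Alice's system, then apply `U` to what she holds. -/
def applyA {A B K A₁ : Type u} [Fintype A] [Fintype B] [Fintype K] [Fintype A₁]
    (ξ : EuclideanSpace ℂ K) (U : Matrix A₁ (A × K) ℂ) (φ : Ket A B) : Ket A₁ B :=
  WithLp.toLp 2 fun x => ∑ y : A × K, U x.1 y * (φ (y.1, x.2) * ξ y.2)

/-- Adjoin an ancilla in the state `ξ` to Bob's system, then apply `U` to what he holds. -/
def applyB {A B K B₁ : Type u} [Fintype A] [Fintype B] [Fintype K] [Fintype B₁]
    (ξ : EuclideanSpace ℂ K) (U : Matrix B₁ (B × K) ℂ) (φ : Ket A B) : Ket A B₁ :=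
  WithLp.toLp 2 fun x => ∑ y : B × K, U x.2 y * (φ (x.1, y.1) * ξ y.2)

/-- Alice's subsystem `D` becomes a subsystem of Bob. -/
def moveToB {A B D : Type u} [Fintype A] [Fintype B] [Fintype D] (φ : Ket (A × D) B) :
    Ket A (B × D) :=
  WithLp.toLp 2 fun x => φ ((x.1, x.2.2), x.2.1)

/-- Bob's subsystem `D` becomes a subsystem of Alice. -/
def moveToA {A B D : Type u} [Fintype A] [Fintype B] [Fintype D] (φ : Ket A (B × D)) :
    Ket (A × D) B :=
  WithLp.toLp 2 fun x => φ (x.1.1, (x.2, x.1.2))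

/-- Two-party protocols that start with Alice holding `ℂ^A` and Bob holding `ℂ^B`, and end with Alice
holding `ℂ^A'` and Bob holding `ℂ^B'`. Each operation is either a local action of one party (adjoin an
ancilla in a pure state, apply a unitary operator to the whole local system, whose range may be
written as any space of the same dimension, such as residual system ⊗ message), or the transmission
of a subsystem `D` to the other party. -/
inductive Protocol (A B : Type u) [Fintype A] [DecidableEq A] [Fintype B] [DecidableEq B] :
    (A' B' : Type u) → [Fintype A'] → [DecidableEq A'] → [Fintype B'] → [DecidableEq B'] →
      Type (u + 1)
  | start : Protocol A B A B
  | localA {A' B' : Type u} [Fintype A'] [DecidableEq A'] [Fintype B'] [DecidableEq B']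
      (p : Protocol A B A' B') (K A₁ : Type u) [Fintype K] [DecidableEq K]
      [Fintype A₁] [DecidableEq A₁] (ξ : EuclideanSpace ℂ K) (hξ : ‖ξ‖ = 1)
      (U : Matrix A₁ (A' × K) ℂ) (hU : U.conjTranspose * U = 1) (hU' : U * U.conjTranspose = 1) :
      Protocol A B A₁ B'
  | localB {A' B' : Type u} [Fintype A'] [DecidableEq A'] [Fintype B'] [DecidableEq B']
      (p : Protocol A B A' B') (K B₁ : Type u) [Fintype K] [DecidableEq K]
      [Fintype B₁] [DecidableEq B₁] (ξ : EuclideanSpace ℂ K) (hξ : ‖ξ‖ = 1)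
      (U : Matrix B₁ (B' × K) ℂ) (hU : U.conjTranspose * U = 1) (hU' : U * U.conjTranspose = 1) :
      Protocol A B A' B₁
  | sendToB {A' B' D : Type u} [Fintype A'] [DecidableEq A'] [Fintype B'] [DecidableEq B']
      [Fintype D] [DecidableEq D] (p : Protocol A B (A' × D) B') : Protocol A B A' (B' × D)
  | sendToA {A' B' D : Type u} [Fintype A'] [DecidableEq A'] [Fintype B'] [DecidableEq B']
      [Fintype D] [DecidableEq D] (p : Protocol A B A' (B' × D)) : Protocol A B (A' × D) B'

namespace Protocol

variable {A B : Type u} [Fintype A] [DecidableEq A] [Fintype B] [DecidableEq B]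

/-- The joint state at the end of the protocol, when it is started in the state `φ`. -/
def run (φ : Ket A B) : {A' B' : Type u} → [Fintype A'] → [DecidableEq A'] → [Fintype B'] →
    [DecidableEq B'] → Protocol A B A' B' → Ket A' B'
  | _, _, _, _, _, _, start => φ
  | _, _, _, _, _, _, localA p _ _ ξ _ U _ _ => applyA ξ U (run φ p)
  | _, _, _, _, _, _, localB p _ _ ξ _ U _ _ => applyB ξ U (run φ p)
  | _, _, _, _, _, _, sendToB p => moveToB (run φ p)
  | _, _, _, _, _, _, sendToA p => moveToA (run φ p)

/-- The number of qubits exchanged: the sum of `log₂ d` over all transmissions, where `d` is the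
dimension of the transmitted system. -/
def cost : {A' B' : Type u} → [Fintype A'] → [DecidableEq A'] → [Fintype B'] →
    [DecidableEq B'] → Protocol A B A' B' → ℝ
  | _, _, _, _, _, _, start => 0
  | _, _, _, _, _, _, localA p _ _ _ _ _ _ _ => cost p
  | _, _, _, _, _, _, localB p _ _ _ _ _ _ _ => cost p
  | _, _, _, _, _, _, sendToB (D := D) p => cost p + Real.logb 2 (Fintype.card D)
  | _, _, _, _, _, _, sendToA (D := D) p => cost p + Real.logb 2 (Fintype.card D)

end Protocol

end

end EntTrans

open EntTrans

/-!
Write a bipartite pure state as its amplitude matrix `F`, rows for Alice and columns for Bob. Alice's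
reduced state is `F Fᴴ`, with rank `rank F` and largest eigenvalue `‖F‖²` (operator norm), so
`Δ₀ = log (rank F * ‖F‖²)`. Local actions multiply `F` by isometries and increase neither quantity;
moving a `d`-dimensional system from one index of `F` to the other multiplies each of the two by at
most `d` (`Protocol.rank_norm_run_le`). Hence the final joint state `v` satisfies
`log (rank * ‖·‖²) ≤ Δ₀(φ) + 2 C`.

It remains to compare `v` with `ψ` (`exists_mem_deltaValues_of_fidelity`). The fidelity hypothesis
gives a unit vector `χ` on the discarded systems for which `v` and `ψ ⊗ χ` have squared overlap at
least `1 - ε` (`exists_overlap_of_fidelity`). In the product of the eigenbases of Alice's parts of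
`ψ` and `χ`, the state `ψ ⊗ χ` has the diagonal reduced operator `q = r ⊗ s`. In the same basis let
`p` be the diagonal of Alice's part of `v`, and `w` the diagonal of the projection onto its support.
Then `p ≤ ‖v‖²` entrywise, `w` is a fractional set of size `rank v`, the total variation distance of
`p` and `q` is at most `√ε = δ⁴ / 2`, and `w` carries all but `ε = δ⁸ / 4` of `q`
(`exists_diagonals_of_overlap`). No perturbation bound for eigenvalues is needed. Markov's
inequality, used for `p`, for `w`, and then for the slices `{i | (i, k) ∈ G}` of the set `G` of good
pairs, yields a slice `J` with `∑ i ∈ J, r i ≥ 1 - δ` and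
`|J| max_J r ≤ rank v * ‖v‖² / (1 - δ)²` (`exists_window`). The logarithm of this bound is the claim.
-/

namespace EntTrans

noncomputable section

/-! ### Bipartite states as matrices -/

/-- The amplitudes of a bipartite vector, arranged as a matrix whose rows belong to Alice and whose
columns belong to Bob. -/
def ampMatrix {A B : Type u} [Fintype A] [Fintype B] (φ : Ket A B) : Matrix A B ℂ :=
  Matrix.of fun a b => φ (a, b)

theorem traceB_ketbra {A B : Type u} [Fintype A] [Fintype B] (φ : Ket A B) :
    traceB (ketbra φ) = ampMatrix φ * (ampMatrix φ).conjTranspose := by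
  ext a a'
  simp [traceB, ketbra, ampMatrix, Matrix.mul_apply]

theorem trace_conjTranspose_mul_ampMatrix {A B : Type u} [Fintype A] [Fintype B] (φ χ : Ket A B) :
    ((ampMatrix φ).conjTranspose * ampMatrix χ).trace = ∑ x, star (φ x) * χ x := by
  simp only [Matrix.trace, Matrix.diag_apply, Matrix.mul_apply, Matrix.conjTranspose_apply,
    ampMatrix, Matrix.of_apply]
  rw [Fintype.sum_prod_type, Finset.sum_comm]

theorem sum_star_mul_self {X : Type u} [Fintype X] (φ : EuclideanSpace ℂ X) :
    ∑ x, star (φ x) * φ x = ((‖φ‖ ^ 2 : ℝ) : ℂ) := by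
  rw [EuclideanSpace.norm_sq_eq]
  push_cast
  exact Finset.sum_congr rfl fun x _ => Complex.conj_mul' (φ x)

theorem trace_ampMatrix_self {A B : Type u} [Fintype A] [Fintype B] (φ : Ket A B) :
    ((ampMatrix φ).conjTranspose * ampMatrix φ).trace = ((‖φ‖ ^ 2 : ℝ) : ℂ) := by
  rw [trace_conjTranspose_mul_ampMatrix, sum_star_mul_self]

/-- A matrix whose columns are an orthonormal basis of the column space of `V`; the second identity
says that the orthogonal projection `Q Qᴴ` fixes the columns of `V`. -/
theorem exists_isometry_onto_columnSpace {X Y : Type*} [Fintype X] [Fintype Y] [DecidableEq X]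
    [DecidableEq Y] (V : Matrix X Y ℂ) :
    ∃ Q : Matrix X (Fin V.rank) ℂ, Q.conjTranspose * Q = 1 ∧ Q * (Q.conjTranspose * V) = V := by
  set S : Submodule ℂ (EuclideanSpace ℂ X) := LinearMap.range (Matrix.toEuclideanLin V) with hS
  have hr : Module.finrank ℂ S = V.rank := by
    rw [Matrix.rank_eq_finrank_range_toLin V (EuclideanSpace.basisFun X ℂ).toBasis
      (EuclideanSpace.basisFun Y ℂ).toBasis, hS, Matrix.toEuclideanLin_eq_toLin_orthonormal]
  set b := (stdOrthonormalBasis ℂ S).reindex (finCongr hr) with hb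
  refine ⟨Matrix.of fun x j => (b j : EuclideanSpace ℂ X) x, ?_, ?_⟩
  · ext i j
    have h := orthonormal_iff_ite.1 b.orthonormal i j
    rw [Submodule.coe_inner, PiLp.inner_apply] at h
    simp only [Matrix.mul_apply, Matrix.conjTranspose_apply, Matrix.of_apply, Matrix.one_apply]
    rw [← h]
    exact Finset.sum_congr rfl fun x _ => by simp [mul_comm]
  · ext x y
    have hm : WithLp.toLp 2 (fun x => V x y) ∈ S := by
      refine ⟨EuclideanSpace.single y 1, ?_⟩
      ext z
      simp [Matrix.toLpLin_apply]
    have h := congrArg (fun v : S => (v : EuclideanSpace ℂ X) x)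
      (b.sum_repr' ⟨_, hm⟩)
    simp only [Submodule.coe_sum, Submodule.coe_smul, Submodule.coe_inner, WithLp.ofLp_sum,
      Finset.sum_apply, PiLp.smul_apply, PiLp.inner_apply, smul_eq_mul] at h
    simp only [Matrix.mul_apply, Matrix.conjTranspose_apply, Matrix.of_apply]
    refine Eq.trans (Finset.sum_congr rfl fun j _ => ?_) h
    rw [mul_comm]
    congr 1
    exact Finset.sum_congr rfl fun z _ => by simp [mul_comm]

/-! ### Effect of a protocol on the amplitude matrix -/

/-- Moving a factor `D` of the row index to the column index multiplies the rank by at most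
`|D|`. -/
theorem rank_move_le {A B D : Type*} [Fintype A] [Fintype B] [Fintype D] [DecidableEq A]
    [DecidableEq B] [DecidableEq D] (F : Matrix (A × D) B ℂ) :
    (Matrix.of fun a (x : B × D) => F (a, x.2) x.1).rank ≤ F.rank * Fintype.card D := by
  obtain ⟨Q, -, hQ⟩ := exists_isometry_onto_columnSpace F
  have h : (Matrix.of fun a (x : B × D) => F (a, x.2) x.1) =
      (Matrix.of fun a (y : Fin F.rank × D) => Q (a, y.2) y.1) *
        Matrix.of fun (y : Fin F.rank × D) (x : B × D) =>
          if y.2 = x.2 then (Q.conjTranspose * F) y.1 x.1 else 0 := by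
    ext a x
    conv_lhs => rw [Matrix.of_apply, ← hQ]
    rw [Matrix.mul_apply, Matrix.mul_apply, Fintype.sum_prod_type]
    simp
  rw [h]
  refine (Matrix.rank_mul_le_left _ _).trans ((Matrix.rank_le_card_width _).trans ?_)
  simp

section Norm

open scoped Matrix.Norms.L2Operator

theorem norm_le_one_of_conjTranspose_mul_self {X Y : Type*} [Fintype X] [Fintype Y] [DecidableEq X]
    [DecidableEq Y] {W : Matrix X Y ℂ} (h : W.conjTranspose * W = 1) : ‖W‖ ≤ 1 := by
  have h1 := Matrix.l2_opNorm_conjTranspose_mul_self W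
  have h2 : ‖(1 : Matrix Y Y ℂ)‖ ≤ 1 := by
    rw [← Matrix.diagonal_one, Matrix.l2_opNorm_diagonal]
    exact (pi_norm_le_iff_of_nonneg zero_le_one).2 fun _ => by simp
  rw [h] at h1
  nlinarith [norm_nonneg W]

theorem norm_le_one_of_mul_conjTranspose_self {X Y : Type*} [Fintype X] [Fintype Y] [DecidableEq X]
    [DecidableEq Y] {W : Matrix X Y ℂ} (h : W * W.conjTranspose = 1) : ‖W‖ ≤ 1 := by
  rw [← Matrix.l2_opNorm_conjTranspose]
  exact norm_le_one_of_conjTranspose_mul_self (by simpa using h)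

/-- Moving a factor `D` of the row index to the column index multiplies the squared operator norm
by at most `|D|`. -/
theorem norm_sq_moveToB_le {A B D : Type*} [Fintype A] [Fintype B] [Fintype D] [DecidableEq A]
    [DecidableEq B] [DecidableEq D] (F : Matrix (A × D) B ℂ) :
    ‖Matrix.of fun a (x : B × D) => F (a, x.2) x.1‖ ^ 2 ≤ ‖F‖ ^ 2 * Fintype.card D := by
  set S : D → Matrix A (A × D) ℂ := fun d => Matrix.of fun a y => if y = (a, d) then 1 else 0
  have hSF : ∀ d, S d * F = Matrix.of fun a b => F (a, d) b := by
    intro d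
    ext a b
    simp [S, Matrix.mul_apply]
  have hS : ∀ d, ‖S d‖ ≤ 1 := by
    intro d
    refine norm_le_one_of_mul_conjTranspose_self ?_
    ext a a'
    simp [S, Matrix.mul_apply, Matrix.one_apply, eq_comm]
  set G := Matrix.of fun a (x : B × D) => F (a, x.2) x.1 with hG
  have hsum : G * G.conjTranspose = ∑ d, (S d * F) * (S d * F).conjTranspose := by
    ext a a'
    rw [Matrix.sum_apply]
    simp only [hSF, hG, Matrix.mul_apply, Matrix.conjTranspose_apply, Matrix.of_apply]
    rw [Fintype.sum_prod_type, Finset.sum_comm]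
  have h1 : ‖G‖ ^ 2 = ‖G * G.conjTranspose‖ := by
    have := Matrix.l2_opNorm_conjTranspose_mul_self G.conjTranspose
    rw [Matrix.conjTranspose_conjTranspose, Matrix.l2_opNorm_conjTranspose] at this
    rw [this, sq]
  rw [h1, hsum]
  refine (norm_sum_le _ _).trans ?_
  have h2 : ∀ d ∈ Finset.univ, ‖S d * F * (S d * F).conjTranspose‖ ≤ ‖F‖ ^ 2 := by
    intro d _
    have h3 : ‖S d * F‖ ≤ ‖F‖ :=
      (Matrix.l2_opNorm_mul _ _).trans (mul_le_of_le_one_left (norm_nonneg _) (hS d))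
    refine (Matrix.l2_opNorm_mul _ _).trans ?_
    rw [Matrix.l2_opNorm_conjTranspose, sq]
    exact mul_le_mul h3 h3 (norm_nonneg _) (norm_nonneg _)
  refine (Finset.sum_le_card_nsmul _ _ _ h2).trans (le_of_eq ?_)
  rw [nsmul_eq_mul, Finset.card_univ, mul_comm]

/-- Moving a factor `D` of the column index to the row index multiplies the squared operator norm
by at most `|D|`. -/
theorem norm_sq_moveToA_le {A B D : Type*} [Fintype A] [Fintype B] [Fintype D] [DecidableEq A]
    [DecidableEq B] [DecidableEq D] (F : Matrix A (B × D) ℂ) :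
    ‖Matrix.of fun (x : A × D) b => F x.1 (b, x.2)‖ ^ 2 ≤ ‖F‖ ^ 2 * Fintype.card D := by
  have h := norm_sq_moveToB_le F.conjTranspose
  rw [Matrix.l2_opNorm_conjTranspose] at h
  rw [← Matrix.l2_opNorm_conjTranspose (Matrix.of fun (x : A × D) b => F x.1 (b, x.2))]
  exact h

end Norm

/-- The isometry by which a party adjoins an ancilla in the state `ξ` and applies `U`. -/
def ancillaIsometry {A K A₁ : Type u} [Fintype A] [Fintype K] (ξ : EuclideanSpace ℂ K)
    (U : Matrix A₁ (A × K) ℂ) : Matrix A₁ A ℂ :=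
  Matrix.of fun x a => ∑ k, U x (a, k) * ξ k

theorem ancillaIsometry_isometry {A K A₁ : Type u} [Fintype A] [Fintype K] [Fintype A₁]
    [DecidableEq A] [DecidableEq K] {ξ : EuclideanSpace ℂ K} (hξ : ‖ξ‖ = 1)
    {U : Matrix A₁ (A × K) ℂ} (hU : U.conjTranspose * U = 1) :
    (ancillaIsometry ξ U).conjTranspose * ancillaIsometry ξ U = 1 := by
  set Z : Matrix (A × K) A ℂ := Matrix.of fun y a => if y.1 = a then ξ y.2 else 0 with hZ
  have h1 : ancillaIsometry ξ U = U * Z := by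
    ext x a
    rw [Matrix.mul_apply, Fintype.sum_prod_type, Finset.sum_comm]
    simp [hZ, ancillaIsometry]
  have h2 : Z.conjTranspose * Z = 1 := by
    ext a a'
    have h := sum_star_mul_self ξ
    rw [hξ] at h
    rw [Matrix.mul_apply, Fintype.sum_prod_type, Finset.sum_comm]
    by_cases haa : a = a'
    · subst haa
      simpa [hZ, Matrix.one_apply] using h
    · simp [hZ, haa, Ne.symm haa]
  rw [h1, Matrix.conjTranspose_mul, Matrix.mul_assoc, ← Matrix.mul_assoc _ U, hU, Matrix.one_mul, h2]

theorem ampMatrix_applyA {A B K A₁ : Type u} [Fintype A] [Fintype B] [Fintype K] [Fintype A₁]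
    (ξ : EuclideanSpace ℂ K) (U : Matrix A₁ (A × K) ℂ) (φ : Ket A B) :
    ampMatrix (applyA ξ U φ) = ancillaIsometry ξ U * ampMatrix φ := by
  ext x b
  simp only [ampMatrix, applyA, ancillaIsometry, Matrix.mul_apply, Matrix.of_apply]
  rw [Fintype.sum_prod_type]
  refine Finset.sum_congr rfl fun a _ => ?_
  rw [Finset.sum_mul]
  exact Finset.sum_congr rfl fun k _ => by ring

theorem ampMatrix_applyB {A B K B₁ : Type u} [Fintype A] [Fintype B] [Fintype K] [Fintype B₁]
    (ξ : EuclideanSpace ℂ K) (U : Matrix B₁ (B × K) ℂ) (φ : Ket A B) :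
    ampMatrix (applyB ξ U φ) = ampMatrix φ * (ancillaIsometry ξ U).transpose := by
  ext a x
  simp only [ampMatrix, applyB, ancillaIsometry, Matrix.mul_apply, Matrix.of_apply,
    Matrix.transpose_apply]
  rw [Fintype.sum_prod_type]
  refine Finset.sum_congr rfl fun a _ => ?_
  rw [Finset.mul_sum]
  exact Finset.sum_congr rfl fun k _ => by ring

theorem norm_applyA {A B K A₁ : Type u} [Fintype A] [Fintype B] [Fintype K] [Fintype A₁]
    [DecidableEq A] [DecidableEq K] {ξ : EuclideanSpace ℂ K} (hξ : ‖ξ‖ = 1)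
    {U : Matrix A₁ (A × K) ℂ} (hU : U.conjTranspose * U = 1) (φ : Ket A B) :
    ‖applyA ξ U φ‖ = ‖φ‖ := by
  have h := trace_ampMatrix_self (applyA ξ U φ)
  rw [ampMatrix_applyA, Matrix.conjTranspose_mul, Matrix.mul_assoc,
    ← Matrix.mul_assoc _ (ancillaIsometry ξ U), ancillaIsometry_isometry hξ hU, Matrix.one_mul,
    trace_ampMatrix_self, Complex.ofReal_inj] at h
  exact ((sq_eq_sq₀ (norm_nonneg _) (norm_nonneg _)).1 h).symm

/-- The transpose of an isometry is a coisometry. -/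
theorem transpose_mul_conjTranspose_transpose {X Y : Type*} [Fintype X] [Fintype Y]
    [DecidableEq Y] {W : Matrix X Y ℂ} (h : W.conjTranspose * W = 1) :
    W.transpose * W.transpose.conjTranspose = 1 := by
  have := congrArg Matrix.transpose h
  rwa [Matrix.transpose_mul, Matrix.transpose_one] at this

theorem norm_applyB {A B K B₁ : Type u} [Fintype A] [Fintype B] [Fintype K] [Fintype B₁]
    [DecidableEq B] [DecidableEq K] {ξ : EuclideanSpace ℂ K} (hξ : ‖ξ‖ = 1)
    {U : Matrix B₁ (B × K) ℂ} (hU : U.conjTranspose * U = 1) (φ : Ket A B) :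
    ‖applyB ξ U φ‖ = ‖φ‖ := by
  have h := trace_ampMatrix_self (applyB ξ U φ)
  rw [ampMatrix_applyB, Matrix.trace_mul_comm, Matrix.conjTranspose_mul, Matrix.mul_assoc,
    ← Matrix.mul_assoc _ _ (ampMatrix φ).conjTranspose,
    transpose_mul_conjTranspose_transpose (ancillaIsometry_isometry hξ hU), Matrix.one_mul,
    Matrix.trace_mul_comm, trace_ampMatrix_self, Complex.ofReal_inj] at h
  exact ((sq_eq_sq₀ (norm_nonneg _) (norm_nonneg _)).1 h).symm

theorem norm_moveToB {A B D : Type u} [Fintype A] [Fintype B] [Fintype D] (φ : Ket (A × D) B) :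
    ‖moveToB φ‖ = ‖φ‖ := by
  rw [EuclideanSpace.norm_eq, EuclideanSpace.norm_eq]
  congr 1
  let e : A × (B × D) ≃ (A × D) × B :=
    ⟨fun x => ((x.1, x.2.2), x.2.1), fun x => (x.1.1, (x.2, x.1.2)), fun _ => rfl, fun _ => rfl⟩
  exact Fintype.sum_equiv e _ _ fun _ => rfl

theorem norm_moveToA {A B D : Type u} [Fintype A] [Fintype B] [Fintype D] (φ : Ket A (B × D)) :
    ‖moveToA φ‖ = ‖φ‖ := by
  rw [EuclideanSpace.norm_eq, EuclideanSpace.norm_eq]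
  congr 1
  let e : (A × D) × B ≃ A × (B × D) :=
    ⟨fun x => (x.1.1, (x.2, x.1.2)), fun x => ((x.1, x.2.2), x.2.1), fun _ => rfl, fun _ => rfl⟩
  exact Fintype.sum_equiv e _ _ fun _ => rfl

namespace Protocol

variable {A B : Type u} [Fintype A] [DecidableEq A] [Fintype B] [DecidableEq B]

theorem norm_run (φ : Ket A B) : ∀ {A' B' : Type u} [Fintype A'] [DecidableEq A'] [Fintype B']
    [DecidableEq B'] (p : Protocol A B A' B'), ‖p.run φ‖ = ‖φ‖ := by
  intro A' B' _ _ _ _ p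
  induction p with
  | start => rfl
  | localA p K A₁ ξ hξ U hU hU' ih => rw [run, norm_applyA hξ hU, ih]
  | localB p K A₁ ξ hξ U hU hU' ih => rw [run, norm_applyB hξ hU, ih]
  | sendToB p ih => rw [run, norm_moveToB, ih]
  | sendToA p ih => rw [run, norm_moveToA, ih]

/-- A transmitted system has positive dimension as soon as the joint state is not zero. -/
theorem two_rpow_logb_card {X D : Type u} [Fintype X] [Fintype D] (f : X → D)
    {φ : EuclideanSpace ℂ X} (h : ‖φ‖ ≠ 0) :
    (2 : ℝ) ^ Real.logb 2 (Fintype.card D) = Fintype.card D := by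
  refine Real.rpow_logb two_pos (by norm_num) ?_
  have : Nonempty X := by
    by_contra hX
    rw [not_nonempty_iff] at hX
    exact h (by rw [EuclideanSpace.norm_eq]; simp)
  have : Nonempty D := this.map f
  exact_mod_cast Fintype.card_pos

open scoped Matrix.Norms.L2Operator in
/-- Along a protocol, the rank and the squared operator norm of the amplitude matrix grow by a
factor of at most `2 ^ cost` each. They are the rank and the largest eigenvalue of Alice's reduced
state. -/
theorem rank_norm_run_le (φ : Ket A B) (hφ : ‖φ‖ ≠ 0) :
    ∀ {A' B' : Type u} [Fintype A'] [DecidableEq A'] [Fintype B']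
    [DecidableEq B'] (p : Protocol A B A' B'),
    ((ampMatrix (p.run φ)).rank : ℝ) ≤ (ampMatrix φ).rank * 2 ^ p.cost ∧
      ‖ampMatrix (p.run φ)‖ ^ 2 ≤ ‖ampMatrix φ‖ ^ 2 * 2 ^ p.cost := by
  intro A' B' _ _ _ _ p
  induction p with
  | start => simp [run, cost]
  | localA p K A₁ ξ hξ U hU hU' ih =>
    rw [run, cost, ampMatrix_applyA]
    have hW := norm_le_one_of_conjTranspose_mul_self (ancillaIsometry_isometry hξ hU)
    have h1 := Matrix.rank_mul_le_right (ancillaIsometry ξ U) (ampMatrix (p.run φ))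
    have h2 := (Matrix.l2_opNorm_mul (ancillaIsometry ξ U) (ampMatrix (p.run φ))).trans
      (mul_le_of_le_one_left (norm_nonneg _) hW)
    exact ⟨(Nat.cast_le.2 h1).trans ih.1, (pow_le_pow_left₀ (norm_nonneg _) h2 2).trans ih.2⟩
  | localB p K A₁ ξ hξ U hU hU' ih =>
    rw [run, cost, ampMatrix_applyB]
    have hW := norm_le_one_of_mul_conjTranspose_self
      (transpose_mul_conjTranspose_transpose (ancillaIsometry_isometry hξ hU))
    have h1 := Matrix.rank_mul_le_left (ampMatrix (p.run φ)) (ancillaIsometry ξ U).transpose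
    have h2 := (Matrix.l2_opNorm_mul (ampMatrix (p.run φ)) (ancillaIsometry ξ U).transpose).trans
      (mul_le_of_le_one_right (norm_nonneg _) hW)
    exact ⟨(Nat.cast_le.2 h1).trans ih.1, (pow_le_pow_left₀ (norm_nonneg _) h2 2).trans ih.2⟩
  | sendToB p ih =>
    rw [run, cost, Real.rpow_add two_pos,
      two_rpow_logb_card (fun x => x.1.2) ((norm_run φ p).trans_ne hφ), ← mul_assoc, ← mul_assoc]
    refine ⟨le_trans ?_ (mul_le_mul_of_nonneg_right ih.1 (Nat.cast_nonneg _)),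
      le_trans ?_ (mul_le_mul_of_nonneg_right ih.2 (Nat.cast_nonneg _))⟩
    · exact_mod_cast rank_move_le (ampMatrix (p.run φ))
    · exact norm_sq_moveToB_le (ampMatrix (p.run φ))
  | sendToA p ih =>
    rw [run, cost, Real.rpow_add two_pos,
      two_rpow_logb_card (fun x => x.2.2) ((norm_run φ p).trans_ne hφ), ← mul_assoc, ← mul_assoc]
    refine ⟨le_trans ?_ (mul_le_mul_of_nonneg_right ih.1 (Nat.cast_nonneg _)),
      le_trans ?_ (mul_le_mul_of_nonneg_right ih.2 (Nat.cast_nonneg _))⟩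
    · have h := rank_move_le (ampMatrix (p.run φ)).transpose
      rw [Matrix.rank_transpose, ← Matrix.rank_transpose] at h
      exact_mod_cast h
    · exact norm_sq_moveToA_le (ampMatrix (p.run φ))

end Protocol

/-! ### Probability vectors -/

/-- Markov's inequality with respect to the weights `q`; the form without division also covers
`κ = 0`. -/
theorem sum_filter_le_of_sum_le {X : Type*} [Fintype X] {g q : X → ℝ} (hg : ∀ x, 0 ≤ g x)
    {κ t : ℝ} (hκ : 0 ≤ κ) (ht : 0 ≤ t) (h : ∑ x, g x ≤ κ * t) :
    ∑ x with ¬ g x ≤ κ * q x, q x ≤ t := by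
  rcases hκ.eq_or_lt with rfl | hκ
  · have h0 : ∑ x, g x = 0 :=
      le_antisymm (by simpa using h) (Finset.sum_nonneg fun x _ => hg x)
    have h1 := (Finset.sum_eq_zero_iff_of_nonneg fun x _ => hg x).1 h0
    rw [Finset.filter_false_of_mem fun x hx => not_not.2 (by rw [h1 x hx, zero_mul])]
    simpa using ht
  · refine le_of_mul_le_mul_left ?_ hκ
    rw [Finset.mul_sum]
    calc _ ≤ ∑ x with ¬ g x ≤ κ * q x, g x :=
          Finset.sum_le_sum fun x hx => (not_le.1 (Finset.mem_filter.1 hx).2).le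
      _ ≤ ∑ x, g x := Finset.sum_le_sum_of_subset_of_nonneg (Finset.filter_subset _ _)
          fun x _ _ => hg x
      _ ≤ _ := h

/-- The total variation distance of two probability vectors is at most `√(1 - F)`, where `√F` is
their Bhattacharyya coefficient. -/
theorem sum_posPart_sub_le {X : Type*} [Fintype X] {p q : X → ℝ} (hp : ∀ x, 0 ≤ p x)
    (hq : ∀ x, 0 ≤ q x) (hp1 : ∑ x, p x = 1) (hq1 : ∑ x, q x = 1) {e n : ℝ}
    (he : 0 ≤ e) (hn : 0 ≤ n) (h : n ≤ ∑ x, √(q x) * √(p x)) (hne : 1 - e ^ 2 ≤ n ^ 2) :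
    ∑ x, max (q x - p x) 0 ≤ e := by
  have h1 : ∑ x, max (q x - p x) 0 = (∑ x, |q x - p x|) / 2 := by
    have h2 : ∀ x, max (q x - p x) 0 = (|q x - p x| + (q x - p x)) / 2 := by
      intro x
      rcases le_total 0 (q x - p x) with h | h
      · rw [max_eq_left h, abs_of_nonneg h]; ring
      · rw [max_eq_right h, abs_of_nonpos h]; ring
    simp_rw [h2]
    rw [← Finset.sum_div, Finset.sum_add_distrib, Finset.sum_sub_distrib, hp1, hq1]
    ring
  set f := ∑ x, √(q x) * √(p x) with hf
  have h3 : ∀ x, |q x - p x| = |√(q x) - √(p x)| * (√(q x) + √(p x)) := by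
    intro x
    rw [← abs_of_nonneg (add_nonneg (Real.sqrt_nonneg (q x)) (Real.sqrt_nonneg (p x))), ← abs_mul]
    congr 1
    nlinarith [Real.sq_sqrt (hp x), Real.sq_sqrt (hq x)]
  have hsq : ∀ x, √(p x) ^ 2 = p x := fun x => Real.sq_sqrt (hp x)
  have hsq' : ∀ x, √(q x) ^ 2 = q x := fun x => Real.sq_sqrt (hq x)
  have h4 : ∑ x, |√(q x) - √(p x)| ^ 2 = 2 - 2 * f := by
    simp_rw [sq_abs, sub_sq, hsq, hsq']
    rw [Finset.sum_add_distrib, Finset.sum_sub_distrib, hp1, hq1, hf, Finset.mul_sum]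
    simp_rw [mul_assoc]
    ring
  have h5 : ∑ x, (√(q x) + √(p x)) ^ 2 = 2 + 2 * f := by
    simp_rw [add_sq, hsq, hsq']
    rw [Finset.sum_add_distrib, Finset.sum_add_distrib, hp1, hq1, hf, Finset.mul_sum]
    simp_rw [mul_assoc]
    ring
  have h6 := Finset.sum_mul_sq_le_sq_mul_sq Finset.univ (fun x => |√(q x) - √(p x)|)
    (fun x => √(q x) + √(p x))
  rw [h4, h5] at h6
  simp_rw [← h3] at h6
  rw [h1, div_le_iff₀ two_pos]
  refine abs_le_of_sq_le_sq' ?_ (by positivity) |>.2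
  nlinarith

/-- With the thresholds `κ = 5 δ / 6` the losses of the three truncations stay within
`(1 - δ)²`. -/
theorem one_sub_sq_le_losses {δ : ℝ} (h0 : 0 ≤ δ) (h1 : δ ≤ 1) :
    (1 - δ) ^ 2 ≤ (1 - 5 / 6 * δ) ^ 2 * (1 - 9 / 10 * δ ^ 2) := by
  have h : (1 - 5 / 6 * δ) ^ 2 * (1 - 9 / 10 * δ ^ 2) - (1 - δ) ^ 2 =
      δ * (1 / 3 - 217 / 180 * δ + 3 / 2 * δ ^ 2 - 5 / 8 * δ ^ 3) := by ring
  have h2 : 0 ≤ 1 / 3 - 217 / 180 * δ + 3 / 2 * δ ^ 2 - 5 / 8 * δ ^ 3 := by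
    nlinarith [mul_nonneg (sub_nonneg.2 h1) (sq_nonneg (δ - 7 / 10)), sq_nonneg (δ - 7 / 10)]
  nlinarith [mul_nonneg h0 h2]

/-- Extraction of a spectral window. Let `q = r ⊗ s` be close to `p`, let `p ≤ M`, and let `w` be a
fractional set of size `R` that carries almost all of `q`. Then some window `J` of `r`, a slice of
the set where `q` is controlled by `M` and `w` is nearly one, carries almost all of `r`, and
`|J| max_J r` is hardly larger than `R M`. -/
theorem exists_window {I K : Type*} [Fintype I] [Fintype K] {r : I → ℝ} {s : K → ℝ}
    {p w : I × K → ℝ} (hr : ∀ i, 0 ≤ r i) (hs : ∀ k, 0 ≤ s k) (hr1 : ∑ i, r i = 1)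
    (hs1 : ∑ k, s k = 1) {δ R M : ℝ} (hδ0 : 0 ≤ δ) (hδ1 : δ < 1) (hpM : ∀ x, p x ≤ M)
    (hw0 : ∀ x, 0 ≤ w x) (hw1 : ∀ x, w x ≤ 1) (hwR : ∑ x, w x ≤ R)
    (hqw : 1 - δ ^ 8 / 4 ≤ ∑ x, r x.1 * s x.2 * w x)
    (hqp : ∑ x : I × K, max (r x.1 * s x.2 - p x) 0 ≤ δ ^ 4 / 2) :
    ∃ J : Finset I, 1 - δ ≤ ∑ i ∈ J, r i ∧
      ∀ i ∈ J, (J.card : ℝ) * r i * (1 - δ) ^ 2 ≤ R * M := by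
  set q : I × K → ℝ := fun x => r x.1 * s x.2 with hqdef
  have hq : ∀ x, 0 ≤ q x := fun x => mul_nonneg (hr _) (hs _)
  have hq1 : ∑ x, q x = 1 := by
    rw [hqdef, Fintype.sum_prod_type]
    simp_rw [← Finset.mul_sum, hs1, mul_one, hr1]
  set κ : ℝ := 5 / 6 * δ with hκ
  have hκ0 : 0 ≤ κ := by positivity
  have hκ1 : 0 < 1 - κ := by rw [hκ]; linarith
  classical
  have hb1 : ∑ x with ¬ max (q x - p x) 0 ≤ κ * q x, q x ≤ 3 / 5 * δ ^ 3 := by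
    refine sum_filter_le_of_sum_le (fun x => le_max_right _ _) hκ0 (by positivity) ?_
    refine hqp.trans (le_of_eq ?_)
    rw [hκ]; ring
  have hb2 : ∑ x with ¬ q x * (1 - w x) ≤ κ * q x, q x ≤ 3 / 10 * δ ^ 3 := by
    refine sum_filter_le_of_sum_le (fun x => mul_nonneg (hq x) (by linarith [hw1 x])) hκ0
      (by positivity) ?_
    have h2 : ∑ x, q x * (1 - w x) = 1 - ∑ x, q x * w x := by
      simp_rw [mul_sub, mul_one]
      rw [Finset.sum_sub_distrib, hq1]
    have h3 : δ ^ 8 ≤ δ ^ 4 := pow_le_pow_of_le_one hδ0 hδ1.le (by norm_num)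
    rw [h2, hκ]
    nlinarith
  -- The pairs where `q` is positive and neither truncation is needed.
  set G : Finset (I × K) := {x | 0 < q x ∧ max (q x - p x) 0 ≤ κ * q x ∧
    q x * (1 - w x) ≤ κ * q x} with hG
  have hGp : ∀ x ∈ G, (1 - κ) * q x ≤ M := by
    intro x hx
    have hx := (Finset.mem_filter.1 hx).2
    linarith [le_max_left (q x - p x) 0, hx.2.1, hpM x]
  have hGw : ∀ x ∈ G, 1 - κ ≤ w x := by
    intro x hx
    have hx := (Finset.mem_filter.1 hx).2
    have : q x * (1 - w x) ≤ q x * κ := by linarith [hx.2.2]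
    linarith [le_of_mul_le_mul_left this hx.1]
  have hGq : 1 - 9 / 10 * δ ^ 3 ≤ ∑ x ∈ G, q x := by
    have h1 : (1 : ℝ) ≤ ∑ x ∈ G, q x + (∑ x with ¬ max (q x - p x) 0 ≤ κ * q x, q x +
        ∑ x with ¬ q x * (1 - w x) ≤ κ * q x, q x) := by
      refine hq1.symm.le.trans ?_
      rw [hG, Finset.sum_filter, Finset.sum_filter, Finset.sum_filter,
        ← Finset.sum_add_distrib, ← Finset.sum_add_distrib]
      refine Finset.sum_le_sum fun x _ => ?_
      have := hq x
      split_ifs with h1 h2 h3 h3 h2 h3 h3 <;> try linarith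
      rcases this.eq_or_lt with h | h
      · linarith
      · exact absurd ⟨h, h2, h3⟩ h1
    linarith
  set J : K → Finset I := fun k => {i | (i, k) ∈ G} with hJ
  have hslice : ∀ f : I × K → ℝ, ∑ x ∈ G, f x = ∑ k, ∑ i ∈ J k, f (i, k) := by
    intro f
    simp_rw [hJ, Finset.sum_filter]
    rw [Finset.sum_comm, ← Fintype.sum_prod_type (f := fun x : I × K => if x ∈ G then f x else 0),
      ← Finset.sum_filter, Finset.filter_univ_mem]
  have hJ1 : ∀ k, ∑ i ∈ J k, r i ≤ 1 := fun k =>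
    hr1 ▸ Finset.sum_le_sum_of_subset_of_nonneg (Finset.subset_univ _) fun i _ _ => hr i
  -- The slices of `G` that carry almost all of `r` have weight at least `1 - 9 δ² / 10` under `s`.
  have hb3 : ∑ k with ¬ s k * (1 - ∑ i ∈ J k, r i) ≤ δ * s k, s k ≤ 9 / 10 * δ ^ 2 := by
    refine sum_filter_le_of_sum_le (fun k => mul_nonneg (hs k) (sub_nonneg.2 (hJ1 k))) hδ0
      (by positivity) ?_
    have h1 : ∑ k, s k * (1 - ∑ i ∈ J k, r i) = 1 - ∑ x ∈ G, q x := by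
      simp_rw [mul_sub, mul_one]
      rw [hslice q, Finset.sum_sub_distrib, hs1]
      refine congrArg _ (Finset.sum_congr rfl fun k _ => ?_)
      rw [Finset.mul_sum]
      exact Finset.sum_congr rfl fun i _ => mul_comm _ _
    rw [h1]
    linarith
  set S : Finset K := {k | s k * (1 - ∑ i ∈ J k, r i) ≤ δ * s k} with hS
  have hS1 : 1 - 9 / 10 * δ ^ 2 ≤ ∑ k ∈ S, s k := by
    have := Finset.sum_filter_add_sum_filter_not Finset.univ
      (fun k => s k * (1 - ∑ i ∈ J k, r i) ≤ δ * s k) s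
    rw [hs1] at this
    linarith
  have hδ2 : 0 < 1 - 9 / 10 * δ ^ 2 := by nlinarith
  have hcard : ∑ k ∈ S, ((J k).card : ℝ) * (1 - κ) ≤ R := by
    calc ∑ k ∈ S, ((J k).card : ℝ) * (1 - κ) ≤ ∑ k, ((J k).card : ℝ) * (1 - κ) :=
          Finset.sum_le_sum_of_subset_of_nonneg (Finset.subset_univ _)
            fun k _ _ => mul_nonneg (Nat.cast_nonneg _) hκ1.le
      _ = ∑ x ∈ G, (1 - κ) := by
          rw [hslice]
          exact Finset.sum_congr rfl fun k _ => by rw [Finset.sum_const, nsmul_eq_mul]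
      _ ≤ ∑ x ∈ G, w x := Finset.sum_le_sum hGw
      _ ≤ ∑ x, w x := Finset.sum_le_sum_of_subset_of_nonneg (Finset.subset_univ _)
            fun x _ _ => hw0 x
      _ ≤ R := hwR
  have hR : 0 ≤ R := (Finset.sum_nonneg fun x _ => hw0 x).trans hwR
  -- Averaging over `s` on its support gives a slice of the right cardinality.
  obtain ⟨k, hkS, hsk, hk⟩ : ∃ k ∈ S, 0 < s k ∧
      ((J k).card : ℝ) * (1 - κ) * (1 - 9 / 10 * δ ^ 2) ≤ R * s k := by
    set S' := S.filter fun k => 0 < s k with hS'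
    have hS'1 : 1 - 9 / 10 * δ ^ 2 ≤ ∑ k ∈ S', s k := by
      rw [hS', Finset.sum_filter_of_ne fun k _ h => (hs k).lt_of_ne' h]
      exact hS1
    have hne : S'.Nonempty := by
      by_contra h
      rw [Finset.not_nonempty_iff_eq_empty.1 h, Finset.sum_empty] at hS'1
      linarith
    obtain ⟨k, hk, hle⟩ := Finset.exists_le_of_sum_le (s := S')
      (f := fun k => ((J k).card : ℝ) * (1 - κ) * (1 - 9 / 10 * δ ^ 2)) (g := fun k => R * s k)
      hne (by
        rw [← Finset.sum_mul, ← Finset.mul_sum]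
        refine mul_le_mul (le_trans ?_ hcard) hS'1 hδ2.le hR
        exact Finset.sum_le_sum_of_subset_of_nonneg (Finset.filter_subset _ _)
            fun k _ _ => mul_nonneg (Nat.cast_nonneg _) hκ1.le)
    exact ⟨k, (Finset.mem_filter.1 hk).1, (Finset.mem_filter.1 hk).2, hle⟩
  refine ⟨J k, ?_, fun i hi => ?_⟩
  · have h1 : s k * (1 - ∑ i ∈ J k, r i) ≤ s k * δ := by
      linarith [(Finset.mem_filter.1 hkS).2]
    linarith [le_of_mul_le_mul_left h1 hsk]
  · have hi' : (1 - κ) * (r i * s k) ≤ M := hGp (i, k) (Finset.mem_filter.1 hi).2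
    have hc : 0 ≤ ((J k).card : ℝ) := Nat.cast_nonneg _
    have h2 := mul_le_mul hk hi' (mul_nonneg hκ1.le (mul_nonneg (hr i) hsk.le))
      (mul_nonneg hR hsk.le)
    have h3 : ((J k).card : ℝ) * r i * ((1 - κ) ^ 2 * (1 - 9 / 10 * δ ^ 2)) ≤ R * M :=
      le_of_mul_le_mul_left (by linarith) hsk
    exact (mul_le_mul_of_nonneg_left (one_sub_sq_le_losses hδ0 hδ1.le)
      (mul_nonneg hc (hr i))).trans h3

/-! ### Row norms and overlaps of matrices -/

theorem mul_conjTranspose_self_apply_self {X Y : Type*} [Fintype Y] (V : Matrix X Y ℂ) (x : X) :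
    (V * V.conjTranspose) x x = ((∑ y, ‖V x y‖ ^ 2 : ℝ) : ℂ) := by
  simp only [Matrix.mul_apply, Matrix.conjTranspose_apply]
  push_cast
  exact Finset.sum_congr rfl fun y _ => Complex.mul_conj' _

theorem trace_mul_conjTranspose_self {X Y : Type*} [Fintype X] [Fintype Y] (V : Matrix X Y ℂ) :
    (V * V.conjTranspose).trace = ((∑ x, ∑ y, ‖V x y‖ ^ 2 : ℝ) : ℂ) := by
  rw [Complex.ofReal_sum]
  exact Finset.sum_congr rfl fun x _ => mul_conjTranspose_self_apply_self V x

open scoped Matrix.Norms.L2Operator in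
theorem sum_row_le_norm_sq {X Y : Type*} [Fintype X] [Fintype Y] [DecidableEq X]
    [DecidableEq Y] (V : Matrix X Y ℂ) (x : X) : ∑ y, ‖V x y‖ ^ 2 ≤ ‖V‖ ^ 2 := by
  have h := Matrix.l2_opNorm_mulVec V.conjTranspose (EuclideanSpace.single x (1 : ℂ))
  rw [Matrix.l2_opNorm_conjTranspose, PiLp.norm_single, norm_one, mul_one] at h
  refine le_trans (le_of_eq ?_) (pow_le_pow_left₀ (norm_nonneg _) h 2)
  rw [EuclideanSpace.norm_sq_eq]
  exact Finset.sum_congr rfl fun y _ => by simp [Matrix.conjTranspose_apply]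

/-- Cauchy–Schwarz row by row. -/
theorem re_trace_conjTranspose_mul_le {X Y : Type*} [Fintype X] [Fintype Y] (U V : Matrix X Y ℂ) :
    (U.conjTranspose * V).trace.re ≤ ∑ x, √(∑ y, ‖U x y‖ ^ 2) * √(∑ y, ‖V x y‖ ^ 2) := by
  rw [Matrix.trace]
  simp only [Matrix.diag_apply, Matrix.mul_apply, Matrix.conjTranspose_apply]
  rw [Finset.sum_comm, Complex.re_sum]
  refine Finset.sum_le_sum fun x _ => (Complex.re_le_norm _).trans ((norm_sum_le _ _).trans ?_)
  simp_rw [norm_mul, norm_star]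
  exact Real.sum_mul_le_sqrt_mul_sqrt _ _ _

open scoped Matrix.Norms.L2Operator in
/-- Let `U` have reduced operator `U Uᴴ = diagonal q`, and let `V` overlap it by at least `n`. The
diagonal `p` of `V Vᴴ` and the diagonal `w` of the projection onto the column space of `V` then
satisfy the closeness conditions under which a spectral window can be extracted. -/
theorem exists_diagonals_of_overlap {X Y : Type*} [Fintype X] [Fintype Y] [DecidableEq X]
    [DecidableEq Y] {U V : Matrix X Y ℂ} {q : X → ℝ}
    (hU : U * U.conjTranspose = Matrix.diagonal fun x => (q x : ℂ)) (hq1 : ∑ x, q x = 1)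
    (hV : (V.conjTranspose * V).trace = 1) {n e : ℝ} (hn : 0 ≤ n) (he : 0 ≤ e)
    (hUV : n ≤ (U.conjTranspose * V).trace.re) (hne : 1 - e ^ 2 ≤ n ^ 2) :
    ∃ p w : X → ℝ, (∀ x, p x ≤ ‖V‖ ^ 2) ∧ ∑ x, max (q x - p x) 0 ≤ e ∧ (∀ x, 0 ≤ w x) ∧
      (∀ x, w x ≤ 1) ∧ ∑ x, w x = V.rank ∧ n ^ 2 ≤ ∑ x, q x * w x := by
  obtain ⟨Q, hQ1, hQ2⟩ := exists_isometry_onto_columnSpace V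
  have hqrow : ∀ x, q x = ∑ y, ‖U x y‖ ^ 2 := by
    intro x
    have h := mul_conjTranspose_self_apply_self U x
    rw [hU, Matrix.diagonal_apply_eq, Complex.ofReal_inj] at h
    exact h
  have hp1 : ∑ x, ∑ y, ‖V x y‖ ^ 2 = 1 := by
    have h := trace_mul_conjTranspose_self V
    rw [Matrix.trace_mul_comm, hV] at h
    exact_mod_cast h.symm
  refine ⟨fun x => ∑ y, ‖V x y‖ ^ 2, fun x => ∑ j, ‖Q x j‖ ^ 2, sum_row_le_norm_sq V, ?_,
    fun x => by positivity, fun x => ?_, ?_, ?_⟩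
  · refine sum_posPart_sub_le (fun x => by positivity) (fun x => ?_) hp1 hq1 he hn ?_ hne
    · rw [hqrow]; positivity
    · simp_rw [hqrow]
      exact hUV.trans (re_trace_conjTranspose_mul_le U V)
  · refine (sum_row_le_norm_sq Q x).trans ?_
    exact pow_le_one₀ (norm_nonneg _) (norm_le_one_of_conjTranspose_mul_self hQ1)
  · have h := trace_mul_conjTranspose_self Q
    rw [Matrix.trace_mul_comm, hQ1, Matrix.trace_one, Fintype.card_fin] at h
    exact_mod_cast h.symm
  · -- `tr (Uᴴ V) = tr ((Qᴴ U)ᴴ (Qᴴ V))`, and the two factors have norms `∑ q w` and `1`.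
    have h1 : (U.conjTranspose * V).trace =
        ((Q.conjTranspose * U).conjTranspose * (Q.conjTranspose * V)).trace := by
      rw [Matrix.conjTranspose_mul, Matrix.conjTranspose_conjTranspose, Matrix.mul_assoc, hQ2]
    have h2 : ∑ j, ∑ y, ‖(Q.conjTranspose * V) j y‖ ^ 2 = 1 := by
      have h := trace_mul_conjTranspose_self (Q.conjTranspose * V)
      rw [Matrix.trace_mul_comm, Matrix.conjTranspose_mul, Matrix.conjTranspose_conjTranspose,
        Matrix.mul_assoc, hQ2, hV] at h
      exact_mod_cast h.symm
    have h3 : ∑ j, ∑ y, ‖(Q.conjTranspose * U) j y‖ ^ 2 = ∑ x, q x * ∑ j, ‖Q x j‖ ^ 2 := by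
      have h := trace_mul_conjTranspose_self (Q.conjTranspose * U)
      rw [Matrix.conjTranspose_mul, Matrix.conjTranspose_conjTranspose, Matrix.mul_assoc,
        ← Matrix.mul_assoc U, hU, Matrix.trace_mul_comm, Matrix.mul_assoc] at h
      rw [← Complex.ofReal_inj, ← h, Matrix.trace, Complex.ofReal_sum]
      refine Finset.sum_congr rfl fun x _ => ?_
      rw [Matrix.diag_apply, Matrix.diagonal_mul, mul_conjTranspose_self_apply_self]
      push_cast
      rfl
    have h4 := hUV.trans_eq (congrArg Complex.re h1)
    have h5 := h4.trans ((re_trace_conjTranspose_mul_le _ _).trans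
      (Real.sum_sqrt_mul_sqrt_le _ (fun j => by positivity) (fun j => by positivity)))
    rw [h2, h3, Real.sqrt_one, mul_one] at h5
    have h6 : 0 ≤ ∑ x, q x * ∑ j, ‖Q x j‖ ^ 2 := by rw [← h3]; positivity
    exact (Real.le_sqrt hn h6).1 h5

/-! ### Fidelity with a pure state -/

theorem ketbra_eq_vecMulVec {X : Type u} [Fintype X] (ψ : EuclideanSpace ℂ X) :
    ketbra ψ = Matrix.vecMulVec ψ.ofLp (star ψ.ofLp) := rfl

theorem trace_sqrt_vecMulVec_star {X : Type u} [Fintype X] [DecidableEq X] (z : X → ℂ) :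
    (CFC.sqrt (Matrix.vecMulVec z (star z))).trace.re ^ 2 = ∑ x, ‖z x‖ ^ 2 := by
  set N : ℝ := ∑ x, ‖z x‖ ^ 2 with hN
  have hN0 : 0 ≤ N := by positivity
  have hz : star z ⬝ᵥ z = (N : ℂ) := by
    rw [hN, dotProduct]
    push_cast
    exact Finset.sum_congr rfl fun x _ => Complex.conj_mul' _
  have hsq : (√N : ℂ) * √N = N := by rw [← Complex.ofReal_mul, Real.mul_self_sqrt hN0]
  have h : CFC.sqrt (Matrix.vecMulVec z (star z)) =
      ((√N)⁻¹ : ℝ) • Matrix.vecMulVec z (star z) := by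
    refine CFC.sqrt_unique ?_ ?_
    · rw [Matrix.smul_mul, Matrix.mul_smul, Matrix.vecMulVec_mul_vecMulVec, hz, smul_smul]
      rcases hN0.eq_or_lt with h0 | h0
      · have : z = 0 := by
          funext x
          have := (Finset.sum_eq_zero_iff_of_nonneg fun x _ => by positivity).1 h0.symm x
            (Finset.mem_univ x)
          simpa using this
        simp [this]
      · ext x y
        have hne : (√N : ℂ) ≠ 0 := by exact_mod_cast (Real.sqrt_pos.2 h0).ne'
        simp only [Matrix.smul_apply, Matrix.vecMulVec_apply, Complex.real_smul, Pi.smul_apply,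
          smul_eq_mul, ← hsq]
        push_cast
        field_simp
    · rw [Matrix.nonneg_iff_posSemidef]
      exact (Matrix.posSemidef_vecMulVec_self_star z).smul (inv_nonneg.2 (Real.sqrt_nonneg _))
  rw [h, Matrix.trace_smul, Matrix.trace_vecMulVec, dotProduct_comm, hz, Complex.smul_re,
    Complex.ofReal_re, smul_eq_mul, mul_pow, inv_pow, Real.sq_sqrt hN0]
  rcases eq_or_ne N 0 with h0 | h0
  · simp [h0]
  · field_simp

/-- The fidelity of `C Cᴴ` with a pure state `ψ` is `⟨ψ| C Cᴴ |ψ⟩`. -/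
theorem fidelity_mul_conjTranspose_ketbra {X Y : Type u} [Fintype X] [DecidableEq X] [Fintype Y]
    (C : Matrix X Y ℂ) (ψ : EuclideanSpace ℂ X) :
    fidelity (C * C.conjTranspose) (ketbra ψ) = ∑ y, ‖∑ x, star (ψ x) * C x y‖ ^ 2 := by
  have hρ : 0 ≤ C * C.conjTranspose :=
    (Matrix.nonneg_iff_posSemidef).2 (Matrix.posSemidef_self_mul_conjTranspose C)
  set T := CFC.sqrt (C * C.conjTranspose) with hT
  have hTT : T * T = C * C.conjTranspose := CFC.sqrt_mul_sqrt_self _ hρ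
  have hTh : T.conjTranspose = T :=
    (Matrix.nonneg_iff_posSemidef.1 (CFC.sqrt_nonneg (C * C.conjTranspose))).isHermitian
  have h1 : T * ketbra ψ * T =
      Matrix.vecMulVec (T.mulVec ψ.ofLp) (star (T.mulVec ψ.ofLp)) := by
    rw [ketbra_eq_vecMulVec, Matrix.mul_vecMulVec, Matrix.vecMulVec_mul, Matrix.star_mulVec, hTh]
  rw [fidelity, ← hT, h1, trace_sqrt_vecMulVec_star, ← Complex.ofReal_inj]
  have h2 : ∀ {W : Type u} [Fintype W] (z : W → ℂ),
      ((∑ x, ‖z x‖ ^ 2 : ℝ) : ℂ) = star z ⬝ᵥ z := by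
    intro W _ z
    rw [dotProduct]
    push_cast
    exact Finset.sum_congr rfl fun x _ => (Complex.conj_mul' _).symm
  have h3 : ∀ y, ‖∑ x, star (ψ x) * C x y‖ = ‖(C.conjTranspose.mulVec ψ.ofLp) y‖ := by
    intro y
    rw [← norm_star, star_sum]
    congr 1
    exact Finset.sum_congr rfl fun x _ => by simp [mul_comm]
  simp_rw [h3]
  rw [h2, h2, Matrix.star_mulVec, Matrix.star_mulVec, Matrix.dotProduct_mulVec,
    Matrix.dotProduct_mulVec, Matrix.vecMul_vecMul, Matrix.vecMul_vecMul, hTh, hTT,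
    Matrix.conjTranspose_conjTranspose]

/-- The vector `ψ ⊗ χ`, with its factors grouped by party. -/
def tensorKet {A A' B B' : Type u} [Fintype A] [Fintype A'] [Fintype B] [Fintype B']
    (ψ : Ket A B) (χ : Ket A' B') : Ket (A × A') (B × B') :=
  WithLp.toLp 2 fun x => ψ (x.1.1, x.2.1) * χ (x.1.2, x.2.2)

/-- Uhlmann's theorem for a pure state `ψ`: a purification `v` of a state that has fidelity
`n ^ 2` with `ψ` has overlap `n` with some extension `ψ ⊗ χ` of `ψ`. -/
theorem exists_overlap_of_fidelity {A A' B B' : Type u} [Fintype A] [Fintype A'] [Fintype B]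
    [Fintype B'] [DecidableEq A] [DecidableEq B] (ψ : Ket A B) (v : Ket (A × A') (B × B'))
    (hF : 0 < fidelity (discardPrimed (ketbra v)) (ketbra ψ)) :
    ∃ χ : Ket A' B', ‖χ‖ = 1 ∧ ∃ n : ℝ, 0 ≤ n ∧
      n ^ 2 = fidelity (discardPrimed (ketbra v)) (ketbra ψ) ∧
      ((ampMatrix (tensorKet ψ χ)).conjTranspose * ampMatrix v).trace = n := by
  set C : Matrix (A × B) (A' × B') ℂ := Matrix.of fun x y => v ((x.1, y.1), (x.2, y.2)) with hC
  have hρ : discardPrimed (ketbra v) = C * C.conjTranspose := by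
    ext x y
    rw [Matrix.mul_apply, Fintype.sum_prod_type]
    rfl
  set c : Ket A' B' := WithLp.toLp 2 fun y => ∑ x, star (ψ x) * C x y with hc
  have hFc : fidelity (discardPrimed (ketbra v)) (ketbra ψ) = ‖c‖ ^ 2 := by
    rw [hρ, fidelity_mul_conjTranspose_ketbra, EuclideanSpace.norm_sq_eq]
  rw [hFc] at hF ⊢
  have hc0 : ‖c‖ ≠ 0 := fun h => by simp [h] at hF
  refine ⟨((‖c‖⁻¹ : ℝ) : ℂ) • c, ?_, ‖c‖, norm_nonneg _, rfl, ?_⟩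
  · rw [norm_smul, Complex.norm_real, norm_inv, norm_norm, inv_mul_cancel₀ hc0]
  · rw [trace_conjTranspose_mul_ampMatrix]
    have h : ∑ x, star (tensorKet ψ (((‖c‖⁻¹ : ℝ) : ℂ) • c) x) * v x =
        ((‖c‖⁻¹ : ℝ) : ℂ) * ∑ y, star (c y) * c y := by
      let e : (A' × B') × (A × B) ≃ (A × A') × (B × B') :=
        ⟨fun y => ((y.2.1, y.1.1), (y.2.2, y.1.2)), fun x => ((x.1.2, x.2.2), (x.1.1, x.2.1)),
          fun _ => rfl, fun _ => rfl⟩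
      rw [← Fintype.sum_equiv e (fun y => star (tensorKet ψ (((‖c‖⁻¹ : ℝ) : ℂ) • c) (e y)) *
        v (e y)) _ fun _ => rfl, Fintype.sum_prod_type, Finset.mul_sum]
      refine Finset.sum_congr rfl fun y _ => ?_
      conv_rhs => rw [show c y = ∑ x, star (ψ x) * C x y from rfl]
      conv_rhs => rw [Finset.mul_sum, Finset.mul_sum]
      refine Finset.sum_congr rfl fun x _ => ?_
      change star (ψ x * (((‖c‖⁻¹ : ℝ) : ℂ) * c y)) * C x y = _
      rw [star_mul', star_mul', Complex.star_def, Complex.conj_ofReal]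
      ring
    rw [h, sum_star_mul_self]
    push_cast
    have : (‖c‖ : ℂ) ≠ 0 := by exact_mod_cast hc0
    field_simp

/-! ### Spectra of reduced states -/

theorem eigenvalues_traceB_nonneg {A B : Type u} [Fintype A] [DecidableEq A] [Fintype B]
    (φ : Ket A B) (i : A) : 0 ≤ (isHermitian_traceB_ketbra φ).eigenvalues i := by
  have h : (traceB (ketbra φ)).PosSemidef := by
    rw [traceB_ketbra]
    exact Matrix.posSemidef_self_mul_conjTranspose _
  exact h.eigenvalues_nonneg i

theorem sum_eigenvalues_traceB {A B : Type u} [Fintype A] [DecidableEq A] [Fintype B]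
    {φ : Ket A B} (hφ : ‖φ‖ = 1) : ∑ i, (isHermitian_traceB_ketbra φ).eigenvalues i = 1 := by
  have h := (isHermitian_traceB_ketbra φ).trace_eq_sum_eigenvalues
  have h0 : (traceB (ketbra φ)).trace = ((1 : ℝ) : ℂ) := by
    rw [traceB_ketbra, Matrix.trace_mul_comm, trace_ampMatrix_self, hφ, one_pow]
  rw [h0] at h
  have h' : ((1 : ℝ) : ℂ) = ((∑ i, (isHermitian_traceB_ketbra φ).eigenvalues i : ℝ) : ℂ) := by
    rw [Complex.ofReal_sum]
    exact h
  exact (Complex.ofReal_inj.1 h').symm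

theorem star_eigenvectorUnitary_mul_mul {A B : Type u} [Fintype A] [DecidableEq A] [Fintype B]
    (φ : Ket A B) :
    ((isHermitian_traceB_ketbra φ).eigenvectorUnitary : Matrix A A ℂ).conjTranspose *
      (ampMatrix φ * (ampMatrix φ).conjTranspose) *
      ((isHermitian_traceB_ketbra φ).eigenvectorUnitary : Matrix A A ℂ) =
      Matrix.diagonal fun i => ((isHermitian_traceB_ketbra φ).eigenvalues i : ℂ) := by
  have h := (isHermitian_traceB_ketbra φ).conjStarAlgAut_star_eigenvectorUnitary
  rw [Unitary.conjStarAlgAut_star_apply] at h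
  rw [← traceB_ketbra]
  exact h

theorem deltaValues_nonempty {A B : Type u} [Fintype A] [DecidableEq A] [Fintype B]
    {φ : Ket A B} (hφ : ‖φ‖ = 1) {ε : ℝ} (hε : 0 ≤ ε) :
    (deltaValues ε (isHermitian_traceB_ketbra φ)).Nonempty := by
  have h1 := sum_eigenvalues_traceB hφ
  have hne : (Finset.univ : Finset A).Nonempty := by
    by_contra h
    rw [Finset.not_nonempty_iff_eq_empty.1 h, Finset.sum_empty] at h1
    exact zero_ne_one h1
  exact ⟨_, Finset.univ, hne, by rw [h1]; linarith, rfl⟩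

/-- `|J| max_J r` is at least the weight of `J`. -/
theorem one_sub_le_of_mem_deltaValues {A : Type u} [Fintype A] [DecidableEq A] {ε : ℝ}
    {ρ : Matrix A A ℂ} {hρ : ρ.IsHermitian} {v : ℝ} (hv : v ∈ deltaValues ε hρ) : 1 - ε ≤ v := by
  obtain ⟨J, hJ, hw, rfl⟩ := hv
  have h := Finset.sum_le_card_nsmul J hρ.eigenvalues (J.sup' hJ hρ.eigenvalues) fun j hj => Finset.le_sup' hρ.eigenvalues hj
  rw [nsmul_eq_mul] at h
  exact hw.trans h

open scoped Matrix.Norms.L2Operator in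
theorem norm_sq_ampMatrix_le {A B : Type u} [Fintype A] [DecidableEq A] [Fintype B] [DecidableEq B]
    (φ : Ket A B) {m : ℝ} (hm0 : 0 ≤ m)
    (hm : ∀ i, (isHermitian_traceB_ketbra φ).eigenvalues i ≤ m) : ‖ampMatrix φ‖ ^ 2 ≤ m := by
  set E := ((isHermitian_traceB_ketbra φ).eigenvectorUnitary : Matrix A A ℂ) with hE
  have hEE : E * E.conjTranspose = 1 :=
    Unitary.coe_mul_star_self (isHermitian_traceB_ketbra φ).eigenvectorUnitary
  have hEn : ‖E‖ ≤ 1 := norm_le_one_of_mul_conjTranspose_self hEE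
  have h := star_eigenvectorUnitary_mul_mul φ
  rw [← hE] at h
  have h1 : ampMatrix φ * (ampMatrix φ).conjTranspose = E * (Matrix.diagonal fun i =>
      ((isHermitian_traceB_ketbra φ).eigenvalues i : ℂ)) * E.conjTranspose := by
    rw [← h, Matrix.mul_assoc, Matrix.mul_assoc, hEE, Matrix.mul_one, ← Matrix.mul_assoc, hEE,
      Matrix.one_mul]
  have h2 := Matrix.l2_opNorm_conjTranspose_mul_self (ampMatrix φ).conjTranspose
  rw [Matrix.conjTranspose_conjTranspose, Matrix.l2_opNorm_conjTranspose, ← sq, h1] at h2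
  have h3 : ‖Matrix.diagonal fun i => ((isHermitian_traceB_ketbra φ).eigenvalues i : ℂ)‖ ≤ m := by
    rw [Matrix.l2_opNorm_diagonal, pi_norm_le_iff_of_nonneg hm0]
    intro i
    rw [Complex.norm_real, Real.norm_of_nonneg (eigenvalues_traceB_nonneg φ i)]
    exact hm i
  rw [← h2]
  refine (Matrix.l2_opNorm_mul _ _).trans ?_
  rw [Matrix.l2_opNorm_conjTranspose]
  refine (mul_le_of_le_one_right (norm_nonneg _) hEn).trans ((Matrix.l2_opNorm_mul _ _).trans ?_)
  exact (mul_le_of_le_one_left (norm_nonneg _) hEn).trans h3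

open scoped Matrix.Norms.L2Operator in
/-- `Δ₀` is at least `log rank + log ‖·‖`: a set of full weight contains all nonzero
eigenvalues. -/
theorem rank_mul_norm_sq_le_of_mem_deltaValues {A B : Type u} [Fintype A] [DecidableEq A]
    [Fintype B] [DecidableEq B] {φ : Ket A B} (hφ : ‖φ‖ = 1) {v : ℝ}
    (hv : v ∈ deltaValues 0 (isHermitian_traceB_ketbra φ)) :
    ((ampMatrix φ).rank : ℝ) * ‖ampMatrix φ‖ ^ 2 ≤ v := by
  obtain ⟨J, hJ, hw, rfl⟩ := hv
  set r := (isHermitian_traceB_ketbra φ).eigenvalues with hr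
  have hr0 : ∀ i, 0 ≤ r i := eigenvalues_traceB_nonneg φ
  have hout : ∀ i, i ∉ J → r i = 0 := by
    intro i hi
    have h1 : ∑ j ∈ insert i J, r j ≤ ∑ j, r j :=
      Finset.sum_le_sum_of_subset_of_nonneg (Finset.subset_univ _) fun j _ _ => hr0 j
    rw [Finset.sum_insert hi, hr, sum_eigenvalues_traceB hφ, ← hr] at h1
    linarith [hr0 i]
  have hm0 : 0 ≤ J.sup' hJ r := by
    obtain ⟨j, hj⟩ := hJ
    exact (hr0 j).trans (Finset.le_sup' r hj)
  refine mul_le_mul ?_ (norm_sq_ampMatrix_le φ hm0 fun i => ?_) (by positivity) (Nat.cast_nonneg _)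
  · rw [← Matrix.rank_self_mul_conjTranspose, ← traceB_ketbra,
      (isHermitian_traceB_ketbra φ).rank_eq_card_non_zero_eigs, Nat.cast_le, Fintype.card_subtype]
    refine Finset.card_le_card fun i hi => ?_
    by_contra h
    exact (Finset.mem_filter.1 hi).2 (hout i h)
  · by_cases hi : i ∈ J
    · exact Finset.le_sup' r hi
    · exact (hout i hi).le.trans hm0

open scoped Matrix.Norms.L2Operator Kronecker in
/-- If a joint pure state `v` approximates `ψ` after discarding `A'` and `B'`, then some element
of `deltaValues δ` for `ψ` is hardly larger than the rank times the largest eigenvalue of Alice's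
part of `v`. -/
theorem exists_mem_deltaValues_of_fidelity {A A' B B' : Type u} [Fintype A] [DecidableEq A]
    [Fintype A'] [DecidableEq A'] [Fintype B] [DecidableEq B] [Fintype B'] [DecidableEq B']
    {ψ : Ket A B} (hψ : ‖ψ‖ = 1) {v : Ket (A × A') (B × B')} (hv : ‖v‖ = 1) {δ : ℝ}
    (hδ0 : 0 ≤ δ) (hδ1 : δ < 1)
    (hF : 1 - δ ^ 8 / 4 ≤ fidelity (discardPrimed (ketbra v)) (ketbra ψ)) :
    ∃ t ∈ deltaValues δ (isHermitian_traceB_ketbra ψ),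
      t * (1 - δ) ^ 2 ≤ (ampMatrix v).rank * ‖ampMatrix v‖ ^ 2 := by
  have hδ8 : δ ^ 8 ≤ 1 := pow_le_one₀ hδ0 hδ1.le
  obtain ⟨χ, hχ, n, hn0, hn2, hn⟩ := exists_overlap_of_fidelity ψ v (by linarith)
  rw [← hn2] at hF
  set r := (isHermitian_traceB_ketbra ψ).eigenvalues with hr
  set s := (isHermitian_traceB_ketbra χ).eigenvalues with hs
  set E := ((isHermitian_traceB_ketbra ψ).eigenvectorUnitary : Matrix A A ℂ) with hE
  set E' := ((isHermitian_traceB_ketbra χ).eigenvectorUnitary : Matrix A' A' ℂ) with hE'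
  have hEE : E * E.conjTranspose = 1 :=
    Unitary.coe_mul_star_self (isHermitian_traceB_ketbra ψ).eigenvectorUnitary
  have hEE' : E' * E'.conjTranspose = 1 :=
    Unitary.coe_mul_star_self (isHermitian_traceB_ketbra χ).eigenvectorUnitary
  -- Alice's system is rotated to the product of the eigenbases of `Tr_B ψ` and `Tr_B' χ`.
  set W := E.conjTranspose ⊗ₖ E'.conjTranspose with hWdef
  have hWW : W.conjTranspose * W = 1 := by
    rw [hWdef, Matrix.conjTranspose_kronecker, ← Matrix.mul_kronecker_mul,
      Matrix.conjTranspose_conjTranspose, Matrix.conjTranspose_conjTranspose, hEE, hEE',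
      Matrix.one_kronecker_one]
  set U := W * ampMatrix (tensorKet ψ χ) with hUdef
  set V := W * ampMatrix v with hVdef
  have htens : ampMatrix (tensorKet ψ χ) = ampMatrix ψ ⊗ₖ ampMatrix χ := rfl
  have hUU : U * U.conjTranspose = Matrix.diagonal fun x => ((r x.1 * s x.2 : ℝ) : ℂ) := by
    have h1 := star_eigenvectorUnitary_mul_mul ψ
    have h2 := star_eigenvectorUnitary_mul_mul χ
    rw [← hE, ← Matrix.mul_assoc, Matrix.mul_assoc] at h1
    rw [← hE', ← Matrix.mul_assoc, Matrix.mul_assoc] at h2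
    rw [hUdef, Matrix.conjTranspose_mul, htens, hWdef, Matrix.conjTranspose_kronecker,
      Matrix.conjTranspose_kronecker, ← Matrix.mul_kronecker_mul, ← Matrix.mul_kronecker_mul,
      ← Matrix.mul_kronecker_mul, Matrix.conjTranspose_conjTranspose,
      Matrix.conjTranspose_conjTranspose, h1, h2, Matrix.diagonal_kronecker_diagonal]
    congr 1
    funext x
    push_cast
    rfl
  have hinner : ∀ {Y Y' : Type u} [Fintype Y] [Fintype Y'] (S : Matrix (A × A') Y ℂ)
      (T : Matrix (A × A') Y' ℂ), (W * S).conjTranspose * (W * T) = S.conjTranspose * T := by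
    intro Y Y' _ _ S T
    rw [Matrix.conjTranspose_mul, Matrix.mul_assoc, ← Matrix.mul_assoc _ W, hWW, Matrix.one_mul]
  have hq1 : ∑ x : A × A', r x.1 * s x.2 = 1 := by
    rw [Fintype.sum_prod_type]
    simp_rw [← Finset.mul_sum, hs, sum_eigenvalues_traceB hχ, mul_one, hr,
      sum_eigenvalues_traceB hψ]
  obtain ⟨p, w, hpM, hqp, hw0, hw1, hwR, hqw⟩ := exists_diagonals_of_overlap (U := U) (V := V)
    (e := δ ^ 4 / 2) hUU hq1
    (by rw [hVdef, hinner, trace_ampMatrix_self, hv, one_pow, Complex.ofReal_one])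
    hn0 (by positivity) (by rw [hUdef, hVdef, hinner, hn, Complex.ofReal_re])
    (by refine le_trans (le_of_eq ?_) hF; ring)
  have hVrank : (V.rank : ℝ) ≤ (ampMatrix v).rank := by
    exact_mod_cast Matrix.rank_mul_le_right W (ampMatrix v)
  have hVnorm : ‖V‖ ≤ ‖ampMatrix v‖ := (Matrix.l2_opNorm_mul _ _).trans
    (mul_le_of_le_one_left (norm_nonneg _) (norm_le_one_of_conjTranspose_mul_self hWW))
  obtain ⟨J, hJ1, hJ2⟩ := exists_window (r := r) (s := s) (p := p) (w := w)
    (R := (ampMatrix v).rank) (M := ‖ampMatrix v‖ ^ 2) (eigenvalues_traceB_nonneg ψ)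
    (eigenvalues_traceB_nonneg χ) (sum_eigenvalues_traceB hψ) (sum_eigenvalues_traceB hχ) hδ0 hδ1
    (fun x => (hpM x).trans (pow_le_pow_left₀ (norm_nonneg _) hVnorm 2)) hw0 hw1
    (hwR.trans_le hVrank) (hF.trans hqw) hqp
  have hJ : J.Nonempty := by
    by_contra h
    rw [Finset.not_nonempty_iff_eq_empty.1 h, Finset.sum_empty] at hJ1
    linarith
  obtain ⟨i, hi, hmax⟩ := Finset.exists_mem_eq_sup' hJ r
  refine ⟨_, ⟨J, hJ, hJ1, rfl⟩, ?_⟩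
  rw [← hr, hmax]
  exact hJ2 i hi

end

end EntTrans

open scoped Matrix.Norms.L2Operator in
theorem theorem2 {A B A₂ B₂ A' B' : Type u}
    [Fintype A] [DecidableEq A] [Fintype B] [DecidableEq B]
    [Fintype A₂] [DecidableEq A₂] [Fintype B₂] [DecidableEq B₂]
    [Fintype A'] [DecidableEq A'] [Fintype B'] [DecidableEq B']
    (φ : Ket A B) (hφ : ‖φ‖ = 1) (ψ : Ket A₂ B₂) (hψ : ‖ψ‖ = 1)
    (ε δ : ℝ) (hε : 0 ≤ ε) (hε' : ε < 1 / 4) (hδ : δ = (4 * ε) ^ (1 / 8 : ℝ))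
    (p : Protocol A B (A₂ × A') (B₂ × B'))
    (hF : 1 - ε ≤ fidelity (discardPrimed (ketbra (p.run φ))) (ketbra ψ)) :
    Delta δ (isHermitian_traceB_ketbra ψ) - Delta 0 (isHermitian_traceB_ketbra φ)
      + 2 * Real.logb 2 (1 - δ) ≤ 2 * p.cost := by
  have h4ε : 0 ≤ 4 * ε := by positivity
  have hδ0 : 0 ≤ δ := hδ ▸ Real.rpow_nonneg h4ε _
  have hδ1 : δ < 1 := hδ ▸ Real.rpow_lt_one h4ε (by linarith) (by norm_num)
  have hδ8 : δ ^ 8 = 4 * ε := by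
    rw [hδ, ← Real.rpow_natCast, ← Real.rpow_mul h4ε]
    norm_num
  obtain ⟨t, ht, htle⟩ := exists_mem_deltaValues_of_fidelity hψ ((p.norm_run φ).trans hφ) hδ0 hδ1
    (hF.trans' (by rw [hδ8]; linarith))
  obtain ⟨hrank, hnorm⟩ := Protocol.rank_norm_run_le φ (by rw [hφ]; exact one_ne_zero) p
  have h1δ : 0 < 1 - δ := by linarith
  have ht0 : 0 < t := h1δ.trans_le (one_sub_le_of_mem_deltaValues ht)
  have hinf : 0 < sInf (deltaValues δ (isHermitian_traceB_ketbra ψ)) :=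
    h1δ.trans_le (le_csInf ⟨t, ht⟩ fun _ h => one_sub_le_of_mem_deltaValues h)
  have hψt : Delta δ (isHermitian_traceB_ketbra ψ) ≤ Real.logb 2 t :=
    Real.logb_le_logb_of_le one_lt_two hinf
      (csInf_le ⟨1 - δ, fun _ h => one_sub_le_of_mem_deltaValues h⟩ ht)
  have h2 : (0 : ℝ) < 2 ^ p.cost := Real.rpow_pos_of_pos two_pos _
  set m := sInf (deltaValues 0 (isHermitian_traceB_ketbra φ)) with hm
  have hφm : ((ampMatrix φ).rank : ℝ) * ‖ampMatrix φ‖ ^ 2 ≤ m :=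
    le_csInf (deltaValues_nonempty hφ le_rfl) fun _ h =>
      rank_mul_norm_sq_le_of_mem_deltaValues hφ h
  have hm0 : 0 < m := lt_of_lt_of_le (by norm_num)
    (le_csInf (deltaValues_nonempty hφ le_rfl) fun _ h => one_sub_le_of_mem_deltaValues h)
  have hmain : t * (1 - δ) ^ 2 ≤ m * (2 ^ p.cost) ^ 2 := by
    calc t * (1 - δ) ^ 2 ≤ _ := htle
      _ ≤ ((ampMatrix φ).rank * 2 ^ p.cost) * (‖ampMatrix φ‖ ^ 2 * 2 ^ p.cost) :=
          mul_le_mul hrank hnorm (by positivity) (by positivity)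
      _ = ((ampMatrix φ).rank * ‖ampMatrix φ‖ ^ 2) * (2 ^ p.cost) ^ 2 := by ring
      _ ≤ _ := mul_le_mul_of_nonneg_right hφm (by positivity)
  have hlog := Real.logb_le_logb_of_le one_lt_two (by positivity) hmain
  rw [Real.logb_mul ht0.ne' (by positivity), Real.logb_mul hm0.ne' (by positivity),
    Real.logb_pow, Real.logb_pow, Real.logb_rpow two_pos (by norm_num)] at hlog
  have hΔ : Delta 0 (isHermitian_traceB_ketbra φ) = Real.logb 2 m := rfl
  rw [hΔ]
  push_cast at hlog
  linarith
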